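/- **Setting.** Let $\Omega\subseteq\mathbb R$ be a measurable frequency band (for instance $[f_c-W/2,f_c+W/2]$, or all of $\mathbb R$) and let $\Omega^{\pm}=\Omega\cup(-\Omega)$. All signals are real. Test functions are the real functions $\varphi(t)=\int a(f)e^{j2\pi ft}\,\mathrm df$ whose spectrum $a$ is bounded and vanishes outside a bounded part of $\Omega^{\pm}$. A random signal $X$ is a generalized second-order random process: a linear map $\varphi\mapsto X(\varphi)=\int X(t)\varphi(t)\,\mathrm dt$ from test functions to square-integrable random variables on a common probability space (white noise is allowed). A filter has a real generalized impulse response $h(t)$, i.e. a real linear functional $\varphi\mapsto\int h(t)\varphi(t)\,\mathrm dt$ on test functions, whose Fourier transform is a measurable function $H(f)$, the frequency response, bounded on bounded parts of $\Omega^{\pm}$; that is, $\int h(t)\varphi(t)\,\mathrm dt=\int a(f)\overline{H(f)}\,\mathrm df$ whenever $\varphi$ has spectrum $a$. The convolution $h\otimes X$ and the delay $X(t-\tau)$ are defined by $(h\otimes X)(\varphi)=X\big(v\mapsto\int h(u)\varphi(v+u)\,\mathrm du\big)$ and $(X(\cdot-\tau))(\varphi)=X(\varphi(\cdot+\tau))$.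 The (cross) power spectral density $S_{YX}$ is the Fourier transform of $R_{YX}(u)=\mathbb E[Y(t+u)X(t)]$; that is, it is integrable on bounded parts of $\Omega^{\pm}$ and $\mathbb E[Y(\varphi)X(\psi)]=\int_{\Omega^{\pm}}S_{YX}(f)\,\overline{a(f)}\,b(f)\,\mathrm df$ for all test functions $\varphi,\psi$ with spectra $a,b$. The power spectral density of $X$ is $S_{XX}$. **The relay channel.** Let $h_{\rm SD},h_{\rm SR},h_{\rm RD},\theta$ be filters with frequency responses $H_{\rm SD},H_{\rm SR},H_{\rm RD},\Theta$, let $\alpha,\tau\in\mathbb R$, and put $\hat\alpha(f)=\alpha e^{-j2\pi\tau f}$. Given a source signal $s$ and noises $n_{\rm R},n_{\rm D}$, the signals $r,x,y$ satisfy $$r(t)=h_{\rm SR}(t)\otimes s(t)+\alpha x(t-\tau)+n_{\rm R}(t),\qquad x(t)=\theta(t)\otimes r(t),$$ $$y(t)=h_{\rm SD}(t)\otimes s(t)+h_{\rm RD}(t)\otimes x(t)+n_{\rm D}(t).$$ Assume that $|1-\hat\alpha(f)\Theta(f)|$ is (essentially) bounded away from $0$ on each bounded part of $\Omega^{\pm}$.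 **Lemma.** For all random signals $s,n_{\rm R},n_{\rm D}$ these equations have a solution $(r,x,y)$, and the following hold. 1. There is a filter $g$ with frequency response $$G(f)=H_{\rm SD}(f)+\frac{H_{\rm RD}(f)H_{\rm SR}(f)\Theta(f)}{1-\hat\alpha(f)\Theta(f)}$$ such that every solution with $n_{\rm R}=n_{\rm D}=0$ satisfies $y=g\otimes s$, and every solution with arbitrary noises satisfies $y=g\otimes s+w$, where $w$ is an output of the same channel with $s$ replaced by $0$ and the same noises (the effective noise). Suppose moreover that $s$ has power spectral density $P(f)$, that $n_{\rm R}$ and $n_{\rm D}$ have constant power spectral density $N_0$, and that $s,n_{\rm R},n_{\rm D}$ are pairwise uncorrelated, i.e. $\mathbb E[X(\varphi)Y(\psi)]=0$ for all test functions $\varphi,\psi$ and any two of them (in particular, they may be independent zero-mean Gaussian signals). Then: 2. In every solution, the cross power spectral density of $y$ and $s$ is $S_{ys}(f)=G(f)P(f)$. 3. The effective noise at the destination, i.e. the output $w$ of the channel for $s=0$, has power spectral density $$\left(\left|\frac{H_{\rm RD}(f)\Theta(f)}{1-\hat\alpha(f)\Theta(f)}\right|^2+1\right)N_0.$$ 4.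 In every solution, the signal $x$ transmitted by the relay has power spectral density $$Q(f)=\left|\frac{\Theta(f)}{1-\hat\alpha(f)\Theta(f)}\right|^2\left(|H_{\rm SR}(f)|^2P(f)+N_0\right).$$ -/

import Mathlib

open MeasureTheory
open scoped InnerProductSpace

noncomputable section

/-- The two-sided band of frequencies belonging to a band `Ω`: a real signal occupying the
frequencies `f ∈ Ω` also occupies the mirror frequencies `-f`. -/
def twoSided (Ω : Set ℝ) : Set ℝ := {f | f ∈ Ω ∨ -f ∈ Ω}

/-- `a` is the spectrum (Fourier transform) of the real test function `φ`: it is bounded, vanishes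
outside a bounded part of the two-sided band, and `φ t = ∫ a(f) exp(j2πft) df`. -/
structure HasSpectrum (Ω : Set ℝ) (φ : ℝ → ℝ) (a : ℝ → ℂ) : Prop where
  memLp : MemLp a ⊤ volume
  support : ∃ B : ℝ, ∀ᵐ f : ℝ, a f ≠ 0 → |f| ≤ B ∧ f ∈ twoSided Ω
  eq : ∀ t : ℝ, (φ t : ℂ) = ∫ f : ℝ, a f * Complex.exp (2 * Real.pi * f * t * Complex.I)

theorem HasSpectrum.integrable {Ω : Set ℝ} {φ : ℝ → ℝ} {a : ℝ → ℂ} (h : HasSpectrum Ω φ a) :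
    Integrable a := by
  obtain ⟨B, hB⟩ := h.support
  have hfin : IsFiniteMeasure (volume.restrict (Set.Icc (-B) B)) := by infer_instance
  have h1 : IntegrableOn a (Set.Icc (-B) B) :=
    (h.memLp.restrict (Set.Icc (-B) B)).integrable le_top
  refine h1.integrable_of_ae_notMem_eq_zero ?_
  filter_upwards [hB] with f hf hn
  by_contra h0
  exact hn (abs_le.mp (hf h0).1)

theorem norm_exp_freq (f t : ℝ) :
    ‖Complex.exp (2 * Real.pi * f * t * Complex.I)‖ = 1 := by
  have := Complex.norm_exp_ofReal_mul_I (2 * Real.pi * f * t)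
  push_cast at this
  exact this

theorem HasSpectrum.integrable_mul_exp {Ω : Set ℝ} {φ : ℝ → ℝ} {a : ℝ → ℂ}
    (h : HasSpectrum Ω φ a) (t : ℝ) :
    Integrable fun f : ℝ => a f * Complex.exp (2 * Real.pi * f * t * Complex.I) := by
  refine h.integrable.mul_bdd (c := 1) ?_ ?_
  · exact (by fun_prop : Continuous fun f : ℝ =>
      Complex.exp (2 * Real.pi * f * t * Complex.I)).aestronglyMeasurable
  · exact Filter.Eventually.of_forall fun f => (norm_exp_freq f t).le

theorem HasSpectrum.zero (Ω : Set ℝ) : HasSpectrum Ω 0 0 :=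
  ⟨MemLp.zero, ⟨0, by simp⟩, by simp⟩

theorem HasSpectrum.add {Ω : Set ℝ} {φ ψ : ℝ → ℝ} {a b : ℝ → ℂ}
    (h : HasSpectrum Ω φ a) (k : HasSpectrum Ω ψ b) : HasSpectrum Ω (φ + ψ) (a + b) := by
  refine ⟨h.memLp.add k.memLp, ?_, fun t => ?_⟩
  · obtain ⟨B, hB⟩ := h.support
    obtain ⟨C, hC⟩ := k.support
    refine ⟨max B C, ?_⟩
    filter_upwards [hB, hC] with f h1 h2 h3
    by_cases ha : a f = 0
    · have hb : b f ≠ 0 := by simpa [ha] using h3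
      exact ⟨(h2 hb).1.trans (le_max_right _ _), (h2 hb).2⟩
    · exact ⟨(h1 ha).1.trans (le_max_left _ _), (h1 ha).2⟩
  · simp only [Pi.add_apply, Complex.ofReal_add, h.eq t, k.eq t, add_mul]
    exact (integral_add (h.integrable_mul_exp t) (k.integrable_mul_exp t)).symm

theorem HasSpectrum.smul {Ω : Set ℝ} {φ : ℝ → ℝ} {a : ℝ → ℂ} (c : ℝ)
    (h : HasSpectrum Ω φ a) : HasSpectrum Ω (c • φ) (fun f => (c : ℂ) * a f) := by
  refine ⟨h.memLp.const_mul (c : ℂ), ?_, fun t => ?_⟩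
  · obtain ⟨B, hB⟩ := h.support
    refine ⟨B, ?_⟩
    filter_upwards [hB] with f h1 h2
    exact h1 (right_ne_zero_of_mul h2)
  · simp only [Pi.smul_apply, smul_eq_mul, Complex.ofReal_mul, h.eq t, mul_assoc]
    exact (integral_const_mul _ _).symm

theorem HasSpectrum.shift {Ω : Set ℝ} {φ : ℝ → ℝ} {a : ℝ → ℂ} (h : HasSpectrum Ω φ a)
    (u : ℝ) : HasSpectrum Ω (fun t => φ (t + u))
      (fun f => a f * Complex.exp (2 * Real.pi * f * u * Complex.I)) := by
  have hm : MemLp (fun f : ℝ => a f * Complex.exp (2 * Real.pi * f * u * Complex.I)) ⊤ volume := by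
    refine h.memLp.of_le (h.integrable_mul_exp u).aestronglyMeasurable ?_
    exact Filter.Eventually.of_forall fun f => by rw [norm_mul, norm_exp_freq, mul_one]
  refine ⟨hm, ?_, fun t => ?_⟩
  · obtain ⟨B, hB⟩ := h.support
    refine ⟨B, ?_⟩
    filter_upwards [hB] with f h1 h2
    exact h1 (left_ne_zero_of_mul h2)
  · rw [h.eq]
    congr 1
    ext f
    rw [mul_assoc (a f), ← Complex.exp_add]
    congr 2
    push_cast
    ring

/-- The real, band-limited test functions whose spectrum lies in the two-sided band of `Ω`.
For `Ω = univ` these are all real functions with bounded, boundedly supported spectrum. -/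
def Test (Ω : Set ℝ) : Submodule ℝ (ℝ → ℝ) where
  carrier := {φ | ∃ a, HasSpectrum Ω φ a}
  zero_mem' := ⟨0, HasSpectrum.zero Ω⟩
  add_mem' := fun ⟨_, h⟩ ⟨_, k⟩ => ⟨_, h.add k⟩
  smul_mem' := fun c _ ⟨_, h⟩ => ⟨_, h.smul c⟩

/-- The translation `φ ↦ φ(· + u)` of test functions. -/
def Test.shift {Ω : Set ℝ} (u : ℝ) : Test Ω →ₗ[ℝ] Test Ω where
  toFun φ := ⟨fun t => φ.1 (t + u), by
    obtain ⟨a, h⟩ := φ.2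
    exact ⟨_, h.shift u⟩⟩
  map_add' _ _ := rfl
  map_smul' _ _ := rfl

/-- A real linear time-invariant filter on the band `Ω`. Its impulse response is a generalized
function `h`, written as the real functional `imp φ = ∫ h(t) φ(t) dt` on test functions (for instance
`imp φ = φ 0` for `h = δ`), and its frequency response `resp` is the Fourier transform of `h`: a
measurable function, bounded on bounded parts of the band, that satisfies the Parseval relation
`∫ h(t) φ(t) dt = ∫ a(f) conj(H(f)) df` for a test function `φ` with spectrum `a`. -/
structure LTIFilter (Ω : Set ℝ) where
  imp : Test Ω →ₗ[ℝ] ℝ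
  resp : ℝ → ℂ
  resp_meas : AEStronglyMeasurable resp volume
  resp_bdd : ∀ B : ℝ, ∃ C : ℝ, ∀ᵐ f : ℝ, f ∈ twoSided Ω → |f| ≤ B → ‖resp f‖ ≤ C
  fourier : ∀ (φ : Test Ω) (a : ℝ → ℂ), HasSpectrum Ω φ.1 a →
    (imp φ : ℂ) = ∫ f : ℝ, a f * starRingEnd ℂ (resp f)

theorem LTIFilter.hasSpectrum_corr {Ω : Set ℝ} (h : LTIFilter Ω) (φ : Test Ω) (a : ℝ → ℂ)
    (ha : HasSpectrum Ω φ.1 a) :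
    HasSpectrum Ω (fun t => h.imp (Test.shift t φ)) (fun f => a f * starRingEnd ℂ (h.resp f)) := by
  obtain ⟨B, hB⟩ := ha.support
  obtain ⟨C, hC⟩ := h.resp_bdd B
  refine ⟨?_, ⟨B, ?_⟩, fun t => ?_⟩
  · refine ha.memLp.of_le_mul (c := C) ?_ ?_
    · exact ha.memLp.aestronglyMeasurable.mul
        (Complex.continuous_conj.comp_aestronglyMeasurable h.resp_meas)
    · filter_upwards [hB, hC] with f h1 h2
      by_cases h0 : a f = 0
      · simp [h0]
      · rw [norm_mul, RCLike.norm_conj, mul_comm]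
        exact mul_le_mul_of_nonneg_right (h2 (h1 h0).2 (h1 h0).1) (norm_nonneg _)
  · filter_upwards [hB] with f h1 h2
    exact h1 (left_ne_zero_of_mul h2)
  · rw [h.fourier (Test.shift t φ) _ (ha.shift t)]
    congr 1
    ext f
    ring

/-- The function `t ↦ ∫ h(u) φ(t + u) du`, i.e. the convolution of a test function with the
time-reversed impulse response. -/
def LTIFilter.corr {Ω : Set ℝ} (h : LTIFilter Ω) : Test Ω →ₗ[ℝ] Test Ω where
  toFun φ := ⟨fun t => h.imp (Test.shift t φ), by
    obtain ⟨a, ha⟩ := φ.2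
    exact ⟨_, h.hasSpectrum_corr φ a ha⟩⟩
  map_add' φ ψ := by
    ext t
    simp
  map_smul' c φ := by
    ext t
    simp

/-- A real generalized random process of second order, observed on the band `Ω`: to a test function
`φ` it assigns the square-integrable random variable `X φ = ∫ X(t) φ(t) dt`, linearly in `φ`.
White noise is a process in this sense. -/
abbrev RandomSignal (Ω : Set ℝ) {E : Type*} [MeasurableSpace E] (μ : Measure E) :=
  Test Ω →ₗ[ℝ] Lp ℝ 2 μ

section Processes

variable {Ω : Set ℝ} {E : Type*} [MeasurableSpace E] {μ : Measure E}

/-- The convolution `h ⊗ X` of a process with an impulse response, tested against `φ`: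
`∫ (∫ h(u) X(t - u) du) φ(t) dt = ∫ X(v) (∫ h(u) φ(v + u) du) dv`. -/
def LTIFilter.conv (h : LTIFilter Ω) (X : RandomSignal Ω μ) : RandomSignal Ω μ := X.comp h.corr

/-- The delayed process `X(t - τ)`, tested against `φ`:
`∫ X(t - τ) φ(t) dt = ∫ X(v) φ(v + τ) dv`. -/
def RandomSignal.delay (τ : ℝ) (X : RandomSignal Ω μ) : RandomSignal Ω μ := X.comp (Test.shift τ)

/-- `S` is the cross power spectral density of `Y` and `X` on the band: the Fourier transform of the
cross-correlation `R(u) = E[Y(t + u) X(t)]`. Tested against `φ` and `ψ` with spectra `a` and `b`,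
`E[Y φ · X ψ] = ∫∫ R(t - s) φ(t) ψ(s) dt ds = ∫ S(f) conj(a(f)) b(f) df`. -/
structure HasCrossPSD (Y X : RandomSignal Ω μ) (S : ℝ → ℂ) : Prop where
  integrableOn : ∀ B : ℝ, IntegrableOn S (twoSided Ω ∩ Set.Icc (-B) B)
  eq : ∀ (φ ψ : Test Ω) (a b : ℝ → ℂ), HasSpectrum Ω φ.1 a → HasSpectrum Ω ψ.1 b →
    ((∫ ω, Y φ ω * X ψ ω ∂μ : ℝ) : ℂ) = ∫ f in twoSided Ω, S f * (starRingEnd ℂ (a f) * b f)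

/-- The autocorrelation of `X` is stationary, with power spectral density `S` on the band: `S` is the Fourier
transform of the autocorrelation of `X`. -/
def HasPSD (X : RandomSignal Ω μ) (S : ℝ → ℝ) : Prop := HasCrossPSD X X fun f => (S f : ℂ)

/-- `E[X φ · Y ψ] = 0` for all test functions. -/
def Uncorrelated (X Y : RandomSignal Ω μ) : Prop :=
  ∀ φ ψ : Test Ω, ∫ ω, X φ ω * Y ψ ω ∂μ = 0

/-- The input-output relations of the relay channel: source signal `s`, noises `nR`, `nD`, relay
input `r`, relay output `x`, destination input `y`. -/
structure RelayChannel (hSD hSR hRD θ : LTIFilter Ω) (α τ : ℝ)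
    (s nR nD r x y : RandomSignal Ω μ) : Prop where
  relay_in : r = hSR.conv s + α • RandomSignal.delay τ x + nR
  relay_out : x = θ.conv r
  dest_in : y = hSD.conv s + hRD.conv x + nD

end Processes

/-- The frequency response `α̂(f) = α exp(-j2πτf)` of the loop-back channel. -/
def loopBack (α τ f : ℝ) : ℂ := α * Complex.exp (-(2 * Real.pi * τ * f * Complex.I))

end

noncomputable section

/-! ### Spectra of real test functions, and filters as Hermitian multipliers. -/

section Spectra

variable {Ω : Set ℝ}

/-! Everything is transferred to test functions. A filtered signal evaluated at `φ` is the signal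
evaluated at `corr φ`, and `corr` multiplies the spectrum of `φ` by the conjugate frequency
response. A spectrum is determined almost everywhere by its test function (`HasSpectrum.ae_eq`) and
determines it, so identities between compositions of filters reduce to pointwise identities of
frequency responses.

The relay equation says that `r` composed with the operator `φ ↦ φ - α θ.corr (shift τ φ)` is the
relay's external input `hSR.conv s + nR`. That operator multiplies spectra by the conjugate of `1 -
loopBack * Θ`, which is bounded away from zero on bounded parts of the band, so dividing by it is
again a multiplier. For the quotient to act on real test functions it must be Hermitian; this
follows from `bandHermitian_resp`, where the realness of the impulse response forces the symmetry of
`Θ`. Hence `feedback_iff`: the solution exists, is unique, and is a filter applied to the input.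

The output then splits by linearity into a filtered source and a noise part. The spectral densities
follow from two rules: filtering either argument of a cross spectrum multiplies it by the response
or its conjugate, and uncorrelated signals contribute no cross terms. -/

theorem measurableSet_twoSided (hΩ : MeasurableSet Ω) : MeasurableSet (twoSided Ω) :=
  hΩ.union (measurable_neg hΩ)

theorem neg_mem_twoSided {f : ℝ} : -f ∈ twoSided Ω ↔ f ∈ twoSided Ω := by
  simp [twoSided, or_comm]

theorem ae_neg {p : ℝ → Prop} (h : ∀ᵐ f : ℝ, p f) : ∀ᵐ f : ℝ, p (-f) :=
  (Measure.measurePreserving_neg (volume : Measure ℝ)).quasiMeasurePreserving.ae h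

/-- Injectivity of the Fourier transform on integrable functions: each smooth compactly supported
`g` is the transform of a Schwartz function `T`, and moving the transform from `T` to `a` gives `∫ g
a = ∫ T â = 0`. -/
theorem ae_eq_zero_of_integral_mul_exp_eq_zero {a : ℝ → ℂ} (ha : Integrable a)
    (h : ∀ t : ℝ, ∫ f : ℝ, a f * Complex.exp (2 * Real.pi * f * t * Complex.I) = 0) :
    ∀ᵐ f : ℝ, a f = 0 := by
  have hF : ∀ w : ℝ, FourierTransform.fourier a w = 0 := fun w => by
    rw [Real.fourier_real_eq_integral_exp_smul, ← h (-w)]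
    refine integral_congr_ae (Filter.Eventually.of_forall fun f => ?_)
    simp only [smul_eq_mul]
    rw [mul_comm]
    congr 2
    push_cast
    ring
  refine ae_eq_zero_of_integral_contDiff_smul_eq_zero ha.locallyIntegrable fun g hg hgc => ?_
  have hgc' : HasCompactSupport fun x => (g x : ℂ) := hgc.comp_left (g := Complex.ofReal) rfl
  let S : SchwartzMap ℝ ℂ := hgc'.toSchwartzMap (Complex.ofRealCLM.contDiff.comp hg)
  let T := FourierTransformInv.fourierInv S
  have hT : FourierTransform.fourier (T : ℝ → ℂ) = S := by
    rw [← SchwartzMap.fourier_coe, FourierTransform.fourier_fourierInv_eq]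
  have key : ∫ x, FourierTransform.fourier (T : ℝ → ℂ) x • a x
      = ∫ x, T x • FourierTransform.fourier a x := by
    simpa using! VectorFourier.integral_fourierIntegral_smul_eq_flip (L := innerₗ ℝ)
      Real.continuous_fourierChar continuous_inner T.integrable ha
  simp only [hF, smul_zero, integral_zero, hT] at key
  rw [← key]
  refine integral_congr_ae (Filter.Eventually.of_forall fun f => ?_)
  exact Complex.real_smul

namespace HasSpectrum

variable {φ ψ : ℝ → ℝ} {a b : ℝ → ℂ}

theorem ae_eq (h : HasSpectrum Ω φ a) (k : HasSpectrum Ω φ b) : a =ᵐ[volume] b := by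
  have := ae_eq_zero_of_integral_mul_exp_eq_zero (h.integrable.sub k.integrable) fun t => by
    simp only [Pi.sub_apply, sub_mul]
    rw [integral_sub (h.integrable_mul_exp t) (k.integrable_mul_exp t), ← h.eq, ← k.eq, sub_self]
  filter_upwards [this] with f hf
  exact sub_eq_zero.mp hf

theorem congr_fun (h : HasSpectrum Ω φ a) (k : HasSpectrum Ω ψ b) (hab : a =ᵐ[volume] b) :
    φ = ψ := by
  ext t
  rw [← Complex.ofReal_inj, h.eq, k.eq]
  refine integral_congr_ae ?_
  filter_upwards [hab] with f hf
  rw [hf]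

theorem ae_mem (h : HasSpectrum Ω φ a) : ∀ᵐ f : ℝ, a f ≠ 0 → f ∈ twoSided Ω := by
  obtain ⟨B, hB⟩ := h.support
  filter_upwards [hB] with f hf h0 using (hf h0).2

/-- Since `φ` is real, conjugating its Fourier integral and reflecting `f` gives a second spectrum;
uniqueness then yields the Hermitian symmetry. -/
theorem conj_neg (h : HasSpectrum Ω φ a) :
    HasSpectrum Ω φ fun f => starRingEnd ℂ (a (-f)) := by
  have hm : MemLp (fun f => a (-f)) ⊤ volume :=
    h.memLp.comp_measurePreserving (Measure.measurePreserving_neg volume)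
  refine ⟨?_, ?_, fun t => ?_⟩
  · exact hm.of_le (Complex.continuous_conj.comp_aestronglyMeasurable hm.aestronglyMeasurable)
      (Filter.Eventually.of_forall fun f => (RCLike.norm_conj _).le)
  · obtain ⟨B, hB⟩ := h.support
    refine ⟨B, ?_⟩
    filter_upwards [ae_neg hB] with f hf h0
    have := hf (by simpa using h0)
    rwa [abs_neg, neg_mem_twoSided] at this
  · rw [← Complex.conj_ofReal, h.eq, ← integral_conj, ← integral_neg_eq_self]
    refine integral_congr_ae (Filter.Eventually.of_forall fun f => ?_)
    simp only [map_mul, ← Complex.exp_conj, Complex.conj_I, Complex.conj_ofReal, map_ofNat]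
    congr 2
    push_cast
    ring

/-- The spectrum of a real function is Hermitian. -/
theorem hermitian (h : HasSpectrum Ω φ a) :
    ∀ᵐ f : ℝ, a (-f) = starRingEnd ℂ (a f) := by
  filter_upwards [h.ae_eq h.conj_neg] with f hf
  rw [hf, Complex.conj_conj]

end HasSpectrum

/-- A bounded Hermitian function with bounded support in the band is the spectrum of a real
function. -/
theorem hasSpectrum_of_hermitian {a : ℝ → ℂ} (hm : MemLp a ⊤ volume)
    (hs : ∃ B : ℝ, ∀ᵐ f : ℝ, a f ≠ 0 → |f| ≤ B ∧ f ∈ twoSided Ω)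
    (hh : ∀ᵐ f : ℝ, a (-f) = starRingEnd ℂ (a f)) :
    HasSpectrum Ω (fun t => (∫ f : ℝ, a f * Complex.exp (2 * Real.pi * f * t * Complex.I)).re)
      a := by
  refine ⟨hm, hs, fun t => ?_⟩
  refine Complex.conj_eq_iff_re.mp ?_
  rw [← integral_conj, ← integral_neg_eq_self]
  refine integral_congr_ae ?_
  filter_upwards [hh] with f hf
  simp only [map_mul, ← Complex.exp_conj, Complex.conj_I, Complex.conj_ofReal, map_ofNat, hf,
    Complex.conj_conj]
  congr 2
  push_cast
  ring

/-- `H` is bounded on bounded parts of the two-sided band. -/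
def BandBounded (Ω : Set ℝ) (H : ℝ → ℂ) : Prop :=
  ∀ B : ℝ, ∃ C : ℝ, ∀ᵐ f : ℝ, f ∈ twoSided Ω → |f| ≤ B → ‖H f‖ ≤ C

/-- `H` is Hermitian on the two-sided band. -/
def BandHermitian (Ω : Set ℝ) (H : ℝ → ℂ) : Prop :=
  ∀ᵐ f : ℝ, f ∈ twoSided Ω → H (-f) = starRingEnd ℂ (H f)

theorem BandBounded.add {H K : ℝ → ℂ} (h : BandBounded Ω H) (k : BandBounded Ω K) :
    BandBounded Ω fun f => H f + K f := fun B => by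
  obtain ⟨C, hC⟩ := h B
  obtain ⟨D, hD⟩ := k B
  refine ⟨C + D, ?_⟩
  filter_upwards [hC, hD] with f h1 h2 hf hB
  exact (norm_add_le _ _).trans (add_le_add (h1 hf hB) (h2 hf hB))

theorem BandBounded.mul {H K : ℝ → ℂ} (h : BandBounded Ω H) (k : BandBounded Ω K) :
    BandBounded Ω fun f => H f * K f := fun B => by
  obtain ⟨C, hC⟩ := h B
  obtain ⟨D, hD⟩ := k B
  refine ⟨C * D, ?_⟩
  filter_upwards [hC, hD] with f h1 h2 hf hB
  rw [norm_mul]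
  exact mul_le_mul (h1 hf hB) (h2 hf hB) (norm_nonneg _) ((norm_nonneg _).trans (h1 hf hB))

theorem BandHermitian.add {H K : ℝ → ℂ} (h : BandHermitian Ω H) (k : BandHermitian Ω K) :
    BandHermitian Ω fun f => H f + K f := by
  filter_upwards [h, k] with f h1 h2 hf
  simp [h1 hf, h2 hf]

theorem BandHermitian.mul {H K : ℝ → ℂ} (h : BandHermitian Ω H) (k : BandHermitian Ω K) :
    BandHermitian Ω fun f => H f * K f := by
  filter_upwards [h, k] with f h1 h2 hf
  simp [h1 hf, h2 hf]

theorem HasSpectrum.memLp_mul_conj {φ : ℝ → ℝ} {a H : ℝ → ℂ} (ha : HasSpectrum Ω φ a)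
    (hm : AEStronglyMeasurable H volume) (hb : BandBounded Ω H) :
    MemLp (fun f => a f * starRingEnd ℂ (H f)) ⊤ volume := by
  obtain ⟨B, hB⟩ := ha.support
  obtain ⟨C, hC⟩ := hb B
  refine ha.memLp.of_le_mul (c := C) ?_ ?_
  · exact ha.memLp.aestronglyMeasurable.mul
      (Complex.continuous_conj.comp_aestronglyMeasurable hm)
  · filter_upwards [hB, hC] with f h1 h2
    by_cases h0 : a f = 0
    · simp [h0]
    · rw [norm_mul, RCLike.norm_conj, mul_comm]
      exact mul_le_mul_of_nonneg_right (h2 (h1 h0).2 (h1 h0).1) (norm_nonneg _)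

/-- Hermitian symmetry of `H` is what keeps the filtered test function real. -/
theorem HasSpectrum.mul_conj {φ : ℝ → ℝ} {a H : ℝ → ℂ} (ha : HasSpectrum Ω φ a)
    (hm : AEStronglyMeasurable H volume) (hb : BandBounded Ω H) (hh : BandHermitian Ω H) :
    HasSpectrum Ω (fun t => (∫ f : ℝ, a f * starRingEnd ℂ (H f) *
      Complex.exp (2 * Real.pi * f * t * Complex.I)).re) fun f => a f * starRingEnd ℂ (H f) := by
  refine hasSpectrum_of_hermitian (ha.memLp_mul_conj hm hb) ?_ ?_
  · obtain ⟨B, hB⟩ := ha.support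
    refine ⟨B, ?_⟩
    filter_upwards [hB] with f h1 h2
    exact h1 (left_ne_zero_of_mul h2)
  · filter_upwards [ha.hermitian, hh, ha.ae_mem] with f h1 h2 h3
    by_cases h0 : a f = 0
    · simp [h1, h0]
    · simp [h1, h2 (h3 h0)]

/-- A spectrum of a test function. -/
def Test.spectrum (φ : Test Ω) : ℝ → ℂ := φ.2.choose

theorem Test.hasSpectrum (φ : Test Ω) : HasSpectrum Ω φ.1 (Test.spectrum φ) := φ.2.choose_spec

namespace LTIFilter

/-- The filter with a given frequency response. -/
def ofResp (H : ℝ → ℂ) (hm : AEStronglyMeasurable H volume) (hb : BandBounded Ω H)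
    (hh : BandHermitian Ω H) : LTIFilter Ω where
  -- The integrand is Hermitian, so its integral is already real and `re` discards nothing.
  -- Linearity holds because spectra are unique almost everywhere, whichever one was chosen.
  imp :=
    { toFun := fun φ => (∫ f : ℝ, (Test.spectrum φ) f * starRingEnd ℂ (H f)).re
      map_add' := fun φ ψ => by
        rw [← Complex.add_re, ← integral_add ((Test.hasSpectrum φ).mul_conj hm hb hh).integrable
          ((Test.hasSpectrum ψ).mul_conj hm hb hh).integrable]
        congr 1
        refine integral_congr_ae ?_
        filter_upwards [(Test.hasSpectrum (φ + ψ)).ae_eq ((Test.hasSpectrum φ).add (Test.hasSpectrum ψ))] with f hf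
        simp [hf, add_mul]
      map_smul' := fun c φ => by
        rw [RingHom.id_apply, smul_eq_mul, ← Complex.re_ofReal_mul, ← integral_const_mul]
        congr 1
        refine integral_congr_ae ?_
        filter_upwards [(Test.hasSpectrum (c • φ)).ae_eq ((Test.hasSpectrum φ).smul c)] with f hf
        simp [hf, mul_assoc] }
  resp := H
  resp_meas := hm
  resp_bdd := hb
  fourier φ a ha := by
    have h0 := (ha.mul_conj hm hb hh).eq 0
    have e : ∫ f : ℝ, (Test.spectrum φ) f * starRingEnd ℂ (H f) = ∫ f : ℝ, a f * starRingEnd ℂ (H f) := by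
      refine integral_congr_ae ?_
      filter_upwards [(Test.hasSpectrum φ).ae_eq ha] with f hf
      rw [hf]
    simp only [Complex.ofReal_zero, mul_zero, zero_mul, Complex.exp_zero, mul_one] at h0
    simp only [LinearMap.coe_mk, AddHom.coe_mk, e, h0]

theorem hasSpectrum_corr_apply (h : LTIFilter Ω) {φ : Test Ω} {a : ℝ → ℂ}
    (ha : HasSpectrum Ω φ.1 a) :
    HasSpectrum Ω (h.corr φ).1 fun f => a f * starRingEnd ℂ (h.resp f) :=
  h.hasSpectrum_corr φ a ha

/-- The frequency response of a real filter is Hermitian on the band. -/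
theorem bandHermitian_resp (hΩ : MeasurableSet Ω) (h : LTIFilter Ω) :
    BandHermitian Ω h.resp := by
  set H := h.resp with hH
  have hmneg : AEStronglyMeasurable (fun f => H (-f)) volume :=
    h.resp_meas.comp_measurePreserving (Measure.measurePreserving_neg volume)
  have hmc : AEStronglyMeasurable (fun f => starRingEnd ℂ (H (-f))) volume :=
    Complex.continuous_conj.comp_aestronglyMeasurable hmneg
  suffices hN : ∀ N : ℕ, ∀ᵐ f : ℝ, f ∈ twoSided Ω → |f| ≤ N → H (-f) = starRingEnd ℂ (H f) by
    filter_upwards [ae_all_iff.mpr hN] with f hf hm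
    obtain ⟨N, hN⟩ := exists_nat_ge |f|
    exact hf N hm hN
  intro N
  let A : Set ℝ := twoSided Ω ∩ {f | |f| ≤ N}
  have hA : MeasurableSet A :=
    (measurableSet_twoSided hΩ).inter (measurableSet_le measurable_norm measurable_const)
  have hAneg : ∀ f, -f ∈ A ↔ f ∈ A := fun f => by
    simp only [A, Set.mem_inter_iff, neg_mem_twoSided, Set.mem_ofPred_eq, abs_neg]
  -- The defect `H f - conj (H (-f))` is anti-Hermitian; the factor `I` makes it Hermitian, hence
  -- the spectrum of a real test function on which the filter can be evaluated.
  let a : ℝ → ℂ := A.indicator fun f => Complex.I * (H f - starRingEnd ℂ (H (-f)))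
  obtain ⟨C, hC⟩ := h.resp_bdd N
  have ham : AEStronglyMeasurable a volume :=
    ((h.resp_meas.sub hmc).const_mul Complex.I).indicator hA
  have hab : ∀ᵐ f : ℝ, ‖a f‖ ≤ |C| + |C| := by
    filter_upwards [hC, ae_neg hC] with f h1 h2
    by_cases hf : f ∈ A
    · have h3 := h1 hf.1 hf.2
      have h4 := h2 (neg_mem_twoSided.mpr hf.1) (by rw [abs_neg]; exact hf.2)
      simp only [a, Set.indicator_of_mem hf, norm_mul, Complex.norm_I, one_mul]
      refine (norm_sub_le _ _).trans (add_le_add (h3.trans (le_abs_self _)) ?_)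
      rw [RCLike.norm_conj]
      exact h4.trans (le_abs_self _)
    · simp only [a, Set.indicator_of_notMem hf, norm_zero]
      positivity
  have hasupp : ∀ f, a f ≠ 0 → f ∈ A := fun f hf => Set.mem_of_indicator_ne_zero hf
  obtain ⟨φ, hs⟩ : ∃ φ, HasSpectrum Ω φ a := by
    refine ⟨_, hasSpectrum_of_hermitian (memLp_top_of_bound ham _ hab) ⟨N, ?_⟩ ?_⟩
    · exact Filter.Eventually.of_forall fun f hf => ⟨(hasupp f hf).2, (hasupp f hf).1⟩
    · refine Filter.Eventually.of_forall fun f => ?_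
      by_cases hf : f ∈ A
      · simp only [a, Set.indicator_of_mem hf, Set.indicator_of_mem ((hAneg f).mpr hf), map_mul,
          map_sub, Complex.conj_I, Complex.conj_conj, neg_neg]
        ring
      · simp only [a, Set.indicator_of_notMem hf,
          Set.indicator_of_notMem (mt (hAneg f).mp hf), map_zero]
  have hcorr := h.hasSpectrum_corr ⟨_, a, hs⟩ a hs
  have hint := hcorr.integrable
  have hherm := hs.hermitian
  have hz := h.fourier ⟨_, a, hs⟩ a hs
  -- The filter output `h.imp` is real, so this integral equals its conjugate; reflecting `f` and
  -- using the symmetry of `a` gives the right side.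
  have hreal : ∫ f : ℝ, a f * starRingEnd ℂ (H f) = ∫ f : ℝ, a f * H (-f) := by
    rw [← hz, ← Complex.conj_ofReal, hz, ← integral_conj, ← integral_neg_eq_self]
    refine integral_congr_ae ?_
    filter_upwards [hherm] with f hf
    simp [hf, H]
  have hint2 : Integrable fun f => a f * H (-f) := by
    refine (Complex.conjCLE.toContinuousLinearMap.integrable_comp hint.comp_neg).congr ?_
    filter_upwards [hherm] with f hf
    simp [hf, hH]
  -- On `A` the conjugate of `a` is `-I * (conj (H f) - H (-f))`, so the squared norm integrates to
  -- a multiple of the difference of the two integrals in `hreal`.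
  have hsq : ∫ f : ℝ, ‖a f‖ ^ 2 = 0 := by
    rw [← Complex.ofReal_inj, ← integral_complex_ofReal]
    have e : ∀ f, (((‖a f‖ ^ 2 : ℝ)) : ℂ) =
        -Complex.I * (a f * starRingEnd ℂ (H f) - a f * H (-f)) := fun f => by
      by_cases hf : f ∈ A
      · rw [Complex.ofReal_pow, ← Complex.mul_conj']
        simp only [a, Set.indicator_of_mem hf, map_mul, map_sub, Complex.conj_I, Complex.conj_conj]
        ring
      · simp [a, Set.indicator_of_notMem hf]
    simp only [e]
    rw [integral_const_mul, integral_sub hint hint2, hreal, sub_self, mul_zero, Complex.ofReal_zero]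
  have hsqi : Integrable fun f => ‖a f‖ ^ 2 := by
    have := hs.integrable.norm.mul_bdd (c := |C| + |C|) ham.norm
      (by simpa using hab)
    simpa [sq] using this
  rw [integral_eq_zero_iff_of_nonneg (fun f => by positivity) hsqi] at hsq
  filter_upwards [hsq] with f hf hm hN
  have hfA : f ∈ A := ⟨hm, hN⟩
  simp only [Pi.zero_apply, ne_eq, OfNat.ofNat_ne_zero, not_false_eq_true, pow_eq_zero_iff,
    norm_eq_zero, a, Set.indicator_of_mem hfA, mul_eq_zero, Complex.I_ne_zero, false_or,
    sub_eq_zero] at hf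
  rw [hf, Complex.conj_conj]

end LTIFilter

end Spectra

/-! ### Calculus of cross spectra under filtering and addition. -/

section CrossSpectra

variable {Ω : Set ℝ} {E : Type*} [MeasurableSpace E] {μ : Measure E}

theorem integral_Lp_mul_eq_inner (u v : Lp ℝ 2 μ) : ∫ ω, u ω * v ω ∂μ = ⟪v, u⟫_ℝ := by
  rw [L2.inner_def]
  rfl

theorem LTIFilter.bandBounded_resp (h : LTIFilter Ω) : BandBounded Ω h.resp := h.resp_bdd

theorem integrableOn_mul_bandBounded (hΩ : MeasurableSet Ω) {S H : ℝ → ℂ} {B : ℝ}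
    (hS : IntegrableOn S (twoSided Ω ∩ Set.Icc (-B) B)) (hm : AEStronglyMeasurable H volume)
    (hb : BandBounded Ω H) : IntegrableOn (fun f => S f * H f) (twoSided Ω ∩ Set.Icc (-B) B) := by
  obtain ⟨C, hC⟩ := hb B
  refine Integrable.mul_bdd (c := C) hS hm.restrict ?_
  rw [ae_restrict_iff' ((measurableSet_twoSided hΩ).inter measurableSet_Icc)]
  filter_upwards [hC] with f hf hA
  exact hf hA.1 (abs_le.mpr hA.2)

namespace HasCrossPSD

variable {X Y X' Y' : RandomSignal Ω μ} {S S' : ℝ → ℂ}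

/-- `S` is integrable only on bounded parts of the band, but the bounded support of `a` confines the
integrand to one of them. -/
theorem integrableOn_mul (hΩ : MeasurableSet Ω) (h : HasCrossPSD Y X S) {φ ψ : ℝ → ℝ}
    {a b : ℝ → ℂ} (ha : HasSpectrum Ω φ a) (hb : HasSpectrum Ω ψ b) :
    IntegrableOn (fun f => S f * (starRingEnd ℂ (a f) * b f)) (twoSided Ω) := by
  obtain ⟨B, hB⟩ := ha.support
  have hprod : MemLp (fun f => starRingEnd ℂ (a f) * b f) ⊤ volume := by
    have hm : MemLp (fun f => starRingEnd ℂ (a f)) ⊤ volume := ha.memLp.star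
    exact hb.memLp.mul' hm
  have h1 : IntegrableOn (fun f => S f * (starRingEnd ℂ (a f) * b f))
      (twoSided Ω ∩ Set.Icc (-B) B) :=
    Integrable.mul_of_top_left (h.integrableOn B) (hprod.restrict _)
  refine h1.of_ae_sdiff_eq_zero (measurableSet_twoSided hΩ).nullMeasurableSet ?_
  filter_upwards [hB] with f hf hd
  by_cases h0 : a f = 0
  · simp [h0]
  · exact absurd ⟨hd.1, abs_le.mp (hf h0).1⟩ hd.2

theorem congr (h : HasCrossPSD Y X S) (hS : ∀ f, S f = S' f) : HasCrossPSD Y X S' := by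
  rwa [funext hS] at h

theorem add_left (hΩ : MeasurableSet Ω) (h : HasCrossPSD Y X S) (h' : HasCrossPSD Y' X S') :
    HasCrossPSD (Y + Y') X fun f => S f + S' f := by
  refine ⟨fun B => (h.integrableOn B).add (h'.integrableOn B), fun φ ψ a b ha hb => ?_⟩
  simp only [add_mul]
  rw [integral_add (h.integrableOn_mul hΩ ha hb) (h'.integrableOn_mul hΩ ha hb),
    ← h.eq φ ψ a b ha hb, ← h'.eq φ ψ a b ha hb, ← Complex.ofReal_add]
  simp only [integral_Lp_mul_eq_inner, LinearMap.add_apply, inner_add_right]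

theorem add_right (hΩ : MeasurableSet Ω) (h : HasCrossPSD Y X S) (h' : HasCrossPSD Y X' S') :
    HasCrossPSD Y (X + X') fun f => S f + S' f := by
  refine ⟨fun B => (h.integrableOn B).add (h'.integrableOn B), fun φ ψ a b ha hb => ?_⟩
  simp only [add_mul]
  rw [integral_add (h.integrableOn_mul hΩ ha hb) (h'.integrableOn_mul hΩ ha hb),
    ← h.eq φ ψ a b ha hb, ← h'.eq φ ψ a b ha hb, ← Complex.ofReal_add]
  simp only [integral_Lp_mul_eq_inner, LinearMap.add_apply, inner_add_left]

/-- Filtering the first signal multiplies the cross spectrum by the frequency response. -/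
theorem conv_left (hΩ : MeasurableSet Ω) (h : HasCrossPSD Y X S) (k : LTIFilter Ω) :
    HasCrossPSD (k.conv Y) X fun f => S f * k.resp f := by
  refine ⟨fun B => integrableOn_mul_bandBounded hΩ (h.integrableOn B) k.resp_meas k.bandBounded_resp,
    fun φ ψ a b ha hb => ?_⟩
  refine (h.eq (k.corr φ) ψ _ b (k.hasSpectrum_corr_apply ha) hb).trans ?_
  refine integral_congr_ae (Filter.Eventually.of_forall fun f => ?_)
  simp only [map_mul, Complex.conj_conj]
  ring

/-- Filtering the second signal multiplies the cross spectrum by the conjugate frequency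
response. -/
theorem conv_right (hΩ : MeasurableSet Ω) (h : HasCrossPSD Y X S) (k : LTIFilter Ω) :
    HasCrossPSD Y (k.conv X) fun f => S f * starRingEnd ℂ (k.resp f) := by
  refine ⟨fun B => integrableOn_mul_bandBounded hΩ (h.integrableOn B)
    (Complex.continuous_conj.comp_aestronglyMeasurable k.resp_meas) fun B => ?_,
    fun φ ψ a b ha hb => ?_⟩
  · obtain ⟨C, hC⟩ := k.resp_bdd B
    exact ⟨C, by simpa only [RCLike.norm_conj] using hC⟩
  · refine (h.eq φ (k.corr ψ) a _ ha (k.hasSpectrum_corr_apply hb)).trans ?_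
    refine integral_congr_ae (Filter.Eventually.of_forall fun f => ?_)
    simp only
    ring

end HasCrossPSD

/-- Filtering a signal multiplies its power spectral density by the squared gain. -/
theorem HasPSD.conv (hΩ : MeasurableSet Ω) {X : RandomSignal Ω μ} {S : ℝ → ℝ} (h : HasPSD X S)
    (k : LTIFilter Ω) : HasPSD (k.conv X) fun f => ‖k.resp f‖ ^ 2 * S f := by
  refine ((HasCrossPSD.conv_left hΩ h k).conv_right hΩ k).congr fun f => ?_
  push_cast
  rw [mul_assoc, Complex.mul_conj', mul_comm]

theorem Uncorrelated.symm {X Y : RandomSignal Ω μ} (h : Uncorrelated X Y) : Uncorrelated Y X :=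
  fun φ ψ => by simpa only [mul_comm] using h ψ φ

/-- Brings uncorrelatedness into the calculus of cross spectra, where it removes the mixed terms. -/
theorem Uncorrelated.hasCrossPSD {X Y : RandomSignal Ω μ} (h : Uncorrelated X Y) :
    HasCrossPSD X Y 0 :=
  ⟨fun _ => integrableOn_zero, fun φ ψ a b _ _ => by simp [h φ ψ]⟩

theorem Uncorrelated.conv_left {X Y : RandomSignal Ω μ} (h : Uncorrelated X Y)
    (k : LTIFilter Ω) : Uncorrelated (k.conv X) Y :=
  fun φ ψ => h (k.corr φ) ψ

theorem Uncorrelated.add_left {X X' Y : RandomSignal Ω μ} (h : Uncorrelated X Y)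
    (h' : Uncorrelated X' Y) : Uncorrelated (X + X') Y := fun φ ψ => by
  have h1 := h φ ψ
  have h2 := h' φ ψ
  rw [integral_Lp_mul_eq_inner] at *
  rw [LinearMap.add_apply, inner_add_right, h1, h2, add_zero]

/-- The power spectral densities of uncorrelated signals add up. -/
theorem HasPSD.add (hΩ : MeasurableSet Ω) {X Y : RandomSignal Ω μ} {S T : ℝ → ℝ} (hX : HasPSD X S)
    (hY : HasPSD Y T) (h : Uncorrelated X Y) : HasPSD (X + Y) fun f => S f + T f := by
  refine ((HasCrossPSD.add_right hΩ hX h.hasCrossPSD).add_left hΩ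
    (h.symm.hasCrossPSD.add_right hΩ hY)).congr fun f => ?_
  simp

end CrossSpectra

/-! ### Inversion of the feedback loop. -/

section Loop

variable {Ω : Set ℝ} {E : Type*} [MeasurableSpace E] {μ : Measure E}

theorem continuous_loopBack (α τ : ℝ) : Continuous (loopBack α τ) := by
  unfold loopBack
  fun_prop

theorem conj_loopBack (α τ f : ℝ) : starRingEnd ℂ (loopBack α τ f) =
    α * Complex.exp (2 * Real.pi * f * τ * Complex.I) := by
  simp only [loopBack, map_mul, ← Complex.exp_conj, Complex.conj_I, Complex.conj_ofReal, map_ofNat,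
    map_neg]
  congr 2
  ring

theorem loopBack_neg (α τ f : ℝ) : loopBack α τ (-f) = starRingEnd ℂ (loopBack α τ f) := by
  rw [conj_loopBack, loopBack]
  congr 2
  push_cast
  ring

variable {θ : LTIFilter Ω} {α τ : ℝ}

/-- The filter that inverts the feedback loop of the relay. -/
def LTIFilter.loopInv (hΩ : MeasurableSet Ω) (θ : LTIFilter Ω) (α τ : ℝ)
    (hloop : ∀ B : ℝ, ∃ c : ℝ, 0 < c ∧ ∀ᵐ f : ℝ, f ∈ twoSided Ω → |f| ≤ B →
      c ≤ ‖1 - loopBack α τ f * θ.resp f‖) : LTIFilter Ω :=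
  LTIFilter.ofResp (fun f => (1 - loopBack α τ f * θ.resp f)⁻¹)
    (aestronglyMeasurable_const.sub
      ((continuous_loopBack α τ).aestronglyMeasurable.mul θ.resp_meas)).inv₀
    (fun B => by
      obtain ⟨c, hc, h⟩ := hloop B
      refine ⟨c⁻¹, ?_⟩
      filter_upwards [h] with f hf hm hB
      rw [norm_inv]
      exact inv_anti₀ hc (hf hm hB))
    (by
      filter_upwards [θ.bandHermitian_resp hΩ] with f hf hm
      simp [hf hm, loopBack_neg])

/-- The lower bound depends on the bounded part of the band, so countably many parts `|f| ≤ N` are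
combined. -/
theorem ae_one_sub_loopBack_mul_ne_zero
    (hloop : ∀ B : ℝ, ∃ c : ℝ, 0 < c ∧ ∀ᵐ f : ℝ, f ∈ twoSided Ω → |f| ≤ B →
      c ≤ ‖1 - loopBack α τ f * θ.resp f‖) :
    ∀ᵐ f : ℝ, f ∈ twoSided Ω → 1 - loopBack α τ f * θ.resp f ≠ 0 := by
  have hN : ∀ N : ℕ, ∀ᵐ f : ℝ, f ∈ twoSided Ω → |f| ≤ N →
      1 - loopBack α τ f * θ.resp f ≠ 0 := fun N => by
    obtain ⟨c, hc, h⟩ := hloop N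
    filter_upwards [h] with f hf hm hB h0
    have := hf hm hB
    rw [h0, norm_zero] at this
    exact absurd hc this.not_gt
  filter_upwards [ae_all_iff.mpr hN] with f hf hm
  obtain ⟨N, hN⟩ := exists_nat_ge |f|
  exact hf N hm hN

theorem Test.ext_of_spectrum {φ ψ : Test Ω} {a b : ℝ → ℂ} (ha : HasSpectrum Ω φ.1 a)
    (hb : HasSpectrum Ω ψ.1 b) (hab : a =ᵐ[volume] b) : φ = ψ :=
  Subtype.ext (ha.congr_fun hb hab)

theorem Test.hasSpectrum_shift {φ : Test Ω} {a : ℝ → ℂ} (ha : HasSpectrum Ω φ.1 a) (u : ℝ) :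
    HasSpectrum Ω (Test.shift u φ).1
      (fun f => a f * Complex.exp (2 * Real.pi * f * u * Complex.I)) :=
  ha.shift u

/-- This is the feedback operator transposed to test functions: translation by `τ` contributes the
conjugate of the delay factor, and `θ.corr` the conjugate of `Θ`. -/
theorem Test.hasSpectrum_loop {φ : Test Ω} {a : ℝ → ℂ} (ha : HasSpectrum Ω φ.1 a)
    (θ : LTIFilter Ω) (α τ : ℝ) :
    HasSpectrum Ω (φ + (-α) • θ.corr (Test.shift τ φ)).1
      fun f => a f * starRingEnd ℂ (1 - loopBack α τ f * θ.resp f) := by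
  have h := ha.add ((θ.hasSpectrum_corr_apply (Test.hasSpectrum_shift ha τ)).smul (-α))
  convert! h using 1
  ext f
  simp only [Pi.add_apply, map_sub, map_one, map_mul, conj_loopBack, Complex.ofReal_neg]
  ring

variable (hΩ : MeasurableSet Ω)
  (hloop : ∀ B : ℝ, ∃ c : ℝ, 0 < c ∧ ∀ᵐ f : ℝ, f ∈ twoSided Ω → |f| ≤ B →
    c ≤ ‖1 - loopBack α τ f * θ.resp f‖)

theorem LTIFilter.loopInv_corr_loop (φ : Test Ω) :
    (θ.loopInv hΩ α τ hloop).corr (φ + (-α) • θ.corr (Test.shift τ φ)) = φ := by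
  have ha := Test.hasSpectrum φ
  refine Test.ext_of_spectrum (LTIFilter.hasSpectrum_corr_apply _
    (Test.hasSpectrum_loop ha θ α τ)) ha ?_
  filter_upwards [ha.ae_mem, ae_one_sub_loopBack_mul_ne_zero hloop] with f h1 h2
  by_cases h0 : Test.spectrum φ f = 0
  · simp [h0]
  · change _ * starRingEnd ℂ (1 - loopBack α τ f * θ.resp f)⁻¹ = _
    rw [mul_assoc, ← map_mul, mul_inv_cancel₀ (h2 (h1 h0)), map_one, mul_one]

theorem LTIFilter.loop_loopInv_corr (φ : Test Ω) :
    (θ.loopInv hΩ α τ hloop).corr φ +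
      (-α) • θ.corr (Test.shift τ ((θ.loopInv hΩ α τ hloop).corr φ)) = φ := by
  have ha := Test.hasSpectrum φ
  refine Test.ext_of_spectrum (Test.hasSpectrum_loop (LTIFilter.hasSpectrum_corr_apply _ ha) θ α τ)
    ha ?_
  filter_upwards [ha.ae_mem, ae_one_sub_loopBack_mul_ne_zero hloop] with f h1 h2
  by_cases h0 : Test.spectrum φ f = 0
  · simp [h0]
  · change _ * starRingEnd ℂ (1 - loopBack α τ f * θ.resp f)⁻¹ * _ = _
    rw [mul_assoc, ← map_mul, inv_mul_cancel₀ (h2 (h1 h0)), map_one, mul_one]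

/-- The feedback equation has the unique solution given by the inverse of the loop. -/
theorem feedback_iff (u r : RandomSignal Ω μ) :
    r = u + α • RandomSignal.delay τ (θ.conv r) ↔ r = (θ.loopInv hΩ α τ hloop).conv u := by
  constructor
  · intro h
    ext1 φ
    -- Testing the equation at the preimage of `φ` under the loop operator: the right inverse gives
    -- uniqueness here, the left inverse gives existence in the converse.
    set ψ := (θ.loopInv hΩ α τ hloop).corr φ with hψ
    have h1 : r ψ = u ψ + α • r (θ.corr (Test.shift τ ψ)) := LinearMap.congr_fun h ψ
    have h2 := congrArg r (LTIFilter.loop_loopInv_corr hΩ hloop φ)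
    rw [map_add, map_smul, ← hψ, h1, neg_smul, add_neg_cancel_right] at h2
    exact h2.symm
  · rintro rfl
    ext1 φ
    have h := congrArg u (LTIFilter.loopInv_corr_loop hΩ hloop φ)
    simp only [map_add, map_smul, neg_smul] at h
    change u _ = u φ + α • u _
    rw [← h, neg_add_cancel_right]

/-- The solutions of the equations of the relay channel. -/
theorem relayChannel_iff {hSD hSR hRD : LTIFilter Ω} {s nR nD r x y : RandomSignal Ω μ} :
    RelayChannel hSD hSR hRD θ α τ s nR nD r x y ↔
      r = (θ.loopInv hΩ α τ hloop).conv (hSR.conv s + nR) ∧ x = θ.conv r ∧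
        y = hSD.conv s + hRD.conv x + nD := by
  rw [← feedback_iff hΩ hloop]
  constructor
  · rintro ⟨h1, h2, h3⟩
    refine ⟨?_, h2, h3⟩
    rw [← h2, add_right_comm]
    exact h1
  · rintro ⟨h1, h2, h3⟩
    refine ⟨?_, h2, h3⟩
    rw [h2, add_right_comm]
    exact h1

end Loop

/-! ### The source-to-destination filter and the lemma itself. -/

section Effective

variable {Ω : Set ℝ} {E : Type*} [MeasurableSpace E] {μ : Measure E}

theorem LTIFilter.conv_add (h : LTIFilter Ω) (X Y : RandomSignal Ω μ) :
    h.conv (X + Y) = h.conv X + h.conv Y := rfl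

theorem LTIFilter.conv_zero (h : LTIFilter Ω) : h.conv (0 : RandomSignal Ω μ) = 0 := rfl

/-- The filter from the source to the destination. -/
def LTIFilter.effective (hΩ : MeasurableSet Ω) (hSD hSR hRD θ : LTIFilter Ω) (α τ : ℝ)
    (hloop : ∀ B : ℝ, ∃ c : ℝ, 0 < c ∧ ∀ᵐ f : ℝ, f ∈ twoSided Ω → |f| ≤ B →
      c ≤ ‖1 - loopBack α τ f * θ.resp f‖) : LTIFilter Ω :=
  let k := θ.loopInv hΩ α τ hloop
  -- The quotient is written as a product with `k.resp`, so that boundedness and symmetry come from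
  -- closure under sums and products.
  LTIFilter.ofResp (fun f => hSD.resp f + hRD.resp f * hSR.resp f * θ.resp f * k.resp f)
    (hSD.resp_meas.add (((hRD.resp_meas.mul hSR.resp_meas).mul θ.resp_meas).mul k.resp_meas))
    (hSD.bandBounded_resp.add (((hRD.bandBounded_resp.mul hSR.bandBounded_resp).mul
      θ.bandBounded_resp).mul k.bandBounded_resp))
    ((hSD.bandHermitian_resp hΩ).add ((((hRD.bandHermitian_resp hΩ).mul
      (hSR.bandHermitian_resp hΩ)).mul (θ.bandHermitian_resp hΩ)).mul (k.bandHermitian_resp hΩ)))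

theorem LTIFilter.effective_conv (hΩ : MeasurableSet Ω) (hSD hSR hRD θ : LTIFilter Ω) (α τ : ℝ)
    (hloop : ∀ B : ℝ, ∃ c : ℝ, 0 < c ∧ ∀ᵐ f : ℝ, f ∈ twoSided Ω → |f| ≤ B →
      c ≤ ‖1 - loopBack α τ f * θ.resp f‖) (s : RandomSignal Ω μ) :
    (LTIFilter.effective hΩ hSD hSR hRD θ α τ hloop).conv s =
      hSD.conv s + hRD.conv (θ.conv ((θ.loopInv hΩ α τ hloop).conv (hSR.conv s))) := by
  ext1 φ
  have ha := Test.hasSpectrum φ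
  -- Both sides evaluate `s` at images of `φ`, so only an equality of test functions remains;
  -- transposition reverses the order of the filters, which is harmless because multipliers commute.
  change s _ = s _ + s _
  rw [← map_add]
  congr 1
  refine Test.ext_of_spectrum (LTIFilter.hasSpectrum_corr_apply _ ha)
    ((hSD.hasSpectrum_corr_apply ha).add (hSR.hasSpectrum_corr_apply
      (LTIFilter.hasSpectrum_corr_apply _ (θ.hasSpectrum_corr_apply
        (hRD.hasSpectrum_corr_apply ha))))) (Filter.Eventually.of_forall fun f => ?_)
  change _ * starRingEnd ℂ (hSD.resp f + hRD.resp f * hSR.resp f * θ.resp f *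
    (θ.loopInv hΩ α τ hloop).resp f) = _
  simp only [Pi.add_apply, map_add, map_mul]
  ring

end Effective

theorem lemma2p1 {E : Type*} [MeasurableSpace E] (μ : Measure E) [IsProbabilityMeasure μ]
    (Ω : Set ℝ) (hΩ : MeasurableSet Ω)
    (hSD hSR hRD θ : LTIFilter Ω) (α τ : ℝ)
    (hloop : ∀ B : ℝ, ∃ c : ℝ, 0 < c ∧ ∀ᵐ f : ℝ, f ∈ twoSided Ω → |f| ≤ B →
      c ≤ ‖1 - loopBack α τ f * θ.resp f‖) :
    -- the relay channel is well-posed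
    (∀ s nR nD : RandomSignal Ω μ, ∃ r x y : RandomSignal Ω μ,
      RelayChannel hSD hSR hRD θ α τ s nR nD r x y) ∧
    -- the effective frequency response between `s` and `y`
    (∃ g : LTIFilter Ω,
      (∀ f : ℝ, g.resp f = hSD.resp f +
        hRD.resp f * hSR.resp f * θ.resp f / (1 - loopBack α τ f * θ.resp f)) ∧
      -- without noise, the output is the input filtered by `g`
      (∀ s r x y : RandomSignal Ω μ, RelayChannel hSD hSR hRD θ α τ s 0 0 r x y → y = g.conv s) ∧
      -- with noise, the output is the input filtered by `g`, plus the output `w` that the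
      -- noise alone produces
      (∀ s nR nD r x y : RandomSignal Ω μ, RelayChannel hSD hSR hRD θ α τ s nR nD r x y →
        ∃ r' x' w : RandomSignal Ω μ, RelayChannel hSD hSR hRD θ α τ 0 nR nD r' x' w ∧
          y = g.conv s + w)) ∧
    ∀ (s nR nD : RandomSignal Ω μ) (P : ℝ → ℝ) (N₀ : ℝ),
      HasPSD s P → HasPSD nR (fun _ => N₀) → HasPSD nD (fun _ => N₀) →
      Uncorrelated s nR → Uncorrelated s nD → Uncorrelated nR nD →
      -- the cross power spectral density of `y` and `s`
      (∀ r x y : RandomSignal Ω μ, RelayChannel hSD hSR hRD θ α τ s nR nD r x y →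
        HasCrossPSD y s (fun f => (hSD.resp f +
          hRD.resp f * hSR.resp f * θ.resp f / (1 - loopBack α τ f * θ.resp f)) * P f)) ∧
      -- the power spectral density of the effective noise at the destination
      (∀ r x w : RandomSignal Ω μ, RelayChannel hSD hSR hRD θ α τ 0 nR nD r x w →
        HasPSD w (fun f =>
          (‖hRD.resp f * θ.resp f / (1 - loopBack α τ f * θ.resp f)‖ ^ 2 + 1) * N₀)) ∧
      -- the power spectral density of the signal transmitted by the relay
      (∀ r x y : RandomSignal Ω μ, RelayChannel hSD hSR hRD θ α τ s nR nD r x y →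
        HasPSD x (fun f =>
          ‖θ.resp f / (1 - loopBack α τ f * θ.resp f)‖ ^ 2 *
            (‖hSR.resp f‖ ^ 2 * P f + N₀))) := by
  set k := θ.loopInv hΩ α τ hloop with hk
  have hkr : ∀ f, k.resp f = (1 - loopBack α τ f * θ.resp f)⁻¹ := fun _ => rfl
  set g := LTIFilter.effective hΩ hSD hSR hRD θ α τ hloop
  have hgr : ∀ f, g.resp f = hSD.resp f +
      hRD.resp f * hSR.resp f * θ.resp f / (1 - loopBack α τ f * θ.resp f) := fun f => by
    rw [div_eq_mul_inv]
    rfl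
  have hgc : ∀ s : RandomSignal Ω μ, g.conv s =
      hSD.conv s + hRD.conv (θ.conv (k.conv (hSR.conv s))) :=
    LTIFilter.effective_conv hΩ hSD hSR hRD θ α τ hloop
  -- Uniqueness of the solution turns every output into an explicit expression, linear in source and
  -- noises.
  have hout : ∀ s nR nD r x y : RandomSignal Ω μ, RelayChannel hSD hSR hRD θ α τ s nR nD r x y →
      y = g.conv s + (hRD.conv (θ.conv (k.conv nR)) + nD) := by
    intro s nR nD r x y h
    obtain ⟨rfl, rfl, rfl⟩ := (relayChannel_iff hΩ hloop).mp h
    rw [hgc]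
    simp only [LTIFilter.conv_add, ← hk]
    abel
  have hex : ∀ s nR nD : RandomSignal Ω μ, ∃ r x y : RandomSignal Ω μ,
      RelayChannel hSD hSR hRD θ α τ s nR nD r x y := fun s nR nD =>
    ⟨_, _, _, (relayChannel_iff hΩ hloop).mpr ⟨rfl, rfl, rfl⟩⟩
  have hnoise : ∀ nR nD r x w : RandomSignal Ω μ, RelayChannel hSD hSR hRD θ α τ 0 nR nD r x w →
      w = hRD.conv (θ.conv (k.conv nR)) + nD := fun nR nD r x w h => by
    simpa only [LTIFilter.conv_zero, zero_add] using hout _ _ _ _ _ _ h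
  refine ⟨hex, ⟨g, hgr, fun s r x y h => ?_, fun s nR nD r x y h => ?_⟩, ?_⟩
  · simpa only [LTIFilter.conv_zero, add_zero] using hout _ _ _ _ _ _ h
  · obtain ⟨r', x', w, hw⟩ := hex 0 nR nD
    exact ⟨r', x', w, hw, by rw [hout _ _ _ _ _ _ h, hnoise _ _ _ _ _ hw]⟩
  · intro s nR nD P N₀ hs hR hD hsR hsD hRD'
    refine ⟨fun r x y h => ?_, fun r x w h => ?_, fun r x y h => ?_⟩
    · rw [hout _ _ _ _ _ _ h]
      -- The noise part adds nothing to the cross spectrum with `s`, leaving only that of `g.conv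
      -- s`.
      have hu : Uncorrelated (hRD.conv (θ.conv (k.conv nR)) + nD) s :=
        (((hsR.symm.conv_left k).conv_left θ).conv_left hRD).add_left hsD.symm
      refine ((HasCrossPSD.conv_left hΩ hs g).add_left hΩ hu.hasCrossPSD).congr fun f => ?_
      rw [hgr, Pi.zero_apply, add_zero, mul_comm]
    · rw [hnoise _ _ _ _ _ h]
      have hu : Uncorrelated (hRD.conv (θ.conv (k.conv nR))) nD :=
        ((hRD'.conv_left k).conv_left θ).conv_left hRD
      refine (HasPSD.add hΩ (((hR.conv hΩ k).conv hΩ θ).conv hΩ hRD) hD hu).congr fun f => ?_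
      simp only [hkr, div_eq_mul_inv, norm_mul]
      congr 1
      ring
    · obtain ⟨rfl, rfl, -⟩ := (relayChannel_iff hΩ hloop).mp h
      refine ((((hs.conv hΩ hSR).add hΩ hR (hsR.conv_left hSR)).conv hΩ k).conv hΩ θ).congr
        fun f => ?_
      simp only [hkr, div_eq_mul_inv, norm_mul]
      congr 1
      ring

end
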